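/- Let $\mathcal{A}$ be a unital $C^*$-algebra and let $H_{\mathcal{A}}=\ell^2(\mathcal{A})$ be the standard right Hilbert $\mathcal{A}$-module: the sequences $x=(x_i)_{i\in\mathbb{N}}$ in $\mathcal{A}$ for which $\sum_i x_i^*x_i$ converges in norm, with $\langle x,y\rangle=\sum_i x_i^*y_i$ and $\|x\|=\|\langle x,x\rangle\|^{1/2}$. Let $B^a(H_{\mathcal{A}})$ be the algebra of all bounded adjointable $\mathcal{A}$-linear operators on $H_{\mathcal{A}}$, with the operator norm. For $F\in B^a(H_{\mathcal{A}})$ consider closed $\mathcal{A}$-submodules $M_1,N_1,M_2,N_2$ of $H_{\mathcal{A}}$ such that $H_{\mathcal{A}}=M_1\,\tilde\oplus\,N_1=M_2\,\tilde\oplus\,N_2$ (direct sums, not necessarily orthogonal), $F$ restricts to an isomorphism of $M_1$ onto $M_2$ (an $\mathcal{A}$-linear bijection, bounded with bounded inverse), and $F(N_1)\subseteq N_2$. One says that $F\in\mathcal{M}\Phi_+(H_{\mathcal{A}})$ if these submodules can be chosen with $N_1$ finitely generated, that $F\in\mathcal{M}\Phi_-(H_{\mathcal{A}})$ if they can be chosen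 with $N_2$ finitely generated, and that $F\in\mathcal{M}\Phi(H_{\mathcal{A}})$ if they can be chosen with both $N_1$ and $N_2$ finitely generated. Here a module is finitely generated if it is the $\mathcal{A}$-linear span of a finite subset. **Theorem 4.1.** The sets $\mathcal{M}\Phi_+(H_{\mathcal{A}})\setminus\mathcal{M}\Phi(H_{\mathcal{A}})$ and $\mathcal{M}\Phi_-(H_{\mathcal{A}})\setminus\mathcal{M}\Phi(H_{\mathcal{A}})$ are open in $B^a(H_{\mathcal{A}})$ with respect to the norm topology. -/

import Mathlib

noncomputable section

/-! ### The standard module `H_A = ℓ²(A)` over a unital C⋆-algebra `A`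

`H_A` is the right Hilbert `A`-module of all sequences `x : ℕ → A` such that `∑ i, (x i)⋆ * x i`
converges in norm, with `⟪x, y⟫ = ∑ i, (x i)⋆ * y i` and `‖x‖ = ‖⟪x, x⟫‖ ^ (1 / 2)`. Right
`A`-modules are modules over `Aᵐᵒᵖ`, as everywhere in Mathlib. -/

namespace StdHilbert

section Summability

variable {A : Type*} [CStarAlgebra A]

theorem summable_of_nonneg_of_le [PartialOrder A] [StarOrderedRing A] {ι : Type*} {f g : ι → A}
    (hf : ∀ i, 0 ≤ f i) (hfg : ∀ i, f i ≤ g i) (hg : Summable g) : Summable f := by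
  rw [summable_iff_vanishing_norm] at hg ⊢
  intro ε hε
  obtain ⟨s, hs⟩ := hg ε hε
  refine ⟨s, fun t ht => lt_of_le_of_lt ?_ (hs t ht)⟩
  exact CStarAlgebra.norm_le_norm_of_nonneg_of_le (Finset.sum_nonneg fun i _ => hf i)
    (Finset.sum_le_sum fun i _ => hfg i)

theorem summable_add {x y : ℕ → A} (hx : Summable fun i => star (x i) * x i)
    (hy : Summable fun i => star (y i) * y i) :
    Summable fun i => star (x i + y i) * (x i + y i) := by
  let _ : PartialOrder A := CStarAlgebra.spectralOrder A
  let _ : StarOrderedRing A := CStarAlgebra.spectralOrderedRing A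
  refine summable_of_nonneg_of_le (fun i => star_mul_self_nonneg _) (fun i => ?_)
    ((hx.add hx).add (hy.add hy))
  have h : star (x i) * x i + star (x i) * x i + (star (y i) * y i + star (y i) * y i)
      = star (x i + y i) * (x i + y i) + star (x i - y i) * (x i - y i) := by
    simp only [star_add, star_sub]
    noncomm_ring
  rw [h]
  exact le_add_of_nonneg_right (star_mul_self_nonneg _)

theorem summable_op_smul {x : ℕ → A} (hx : Summable fun i => star (x i) * x i) (a : A) :
    Summable fun i => star (x i * a) * (x i * a) := by
  have h := (hx.mul_left (star a)).mul_right a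
  simpa [mul_assoc] using h

theorem summable_inner {x y : ℕ → A} (hx : Summable fun i => star (x i) * x i)
    (hy : Summable fun i => star (y i) * y i) : Summable fun i => star (x i) * y i := by
  have key : ∀ c : A, Summable fun i => star (x i + y i * c) * (x i + y i * c) := fun c =>
    summable_add hx (summable_op_smul hy c)
  have h1 := key 1
  have h2 := key (-1)
  have h3 := key (Complex.I • 1)
  have h4 := key (-(Complex.I • 1))
  have h := (((h1.sub h2).sub (h3.const_smul Complex.I)).add
    (h4.const_smul Complex.I)).const_smul (1 / 4 : ℂ)
  refine h.congr fun i => ?_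
  simp only [mul_one, mul_neg, mul_smul_comm, star_add, star_neg, star_smul, add_mul, mul_add,
    neg_mul, smul_mul_assoc, smul_add, smul_neg, smul_sub, smul_smul, Complex.star_def,
    Complex.conj_I]
  match_scalars <;> ring_nf <;> norm_num [Complex.I_sq]

end Summability

/-- The sequences `x` in `A` for which `∑ i, (x i)⋆ * x i` converges in norm, as a right
`A`-submodule of `ℕ → A`. All terms are positive, so unconditional convergence is the same as
convergence of the partial sums. -/
def squareSummable (A : Type*) [CStarAlgebra A] : Submodule Aᵐᵒᵖ (ℕ → A) where
  carrier := {x | Summable fun i => star (x i) * x i}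
  add_mem' hx hy := summable_add hx hy
  zero_mem' := by simp
  smul_mem' a _ hx := summable_op_smul hx a.unop

/-- The standard module `H_A`. It is a type of its own, so that its topology is the one of the
Hilbert module norm, not the one of pointwise convergence. -/
def HA (A : Type*) [CStarAlgebra A] : Type _ := squareSummable A

variable (A : Type*) [CStarAlgebra A]

instance : AddCommGroup (HA A) := inferInstanceAs (AddCommGroup (squareSummable A))

instance : Module Aᵐᵒᵖ (HA A) := inferInstanceAs (Module Aᵐᵒᵖ (squareSummable A))

instance : Module ℂ (HA A) := inferInstanceAs (Module ℂ (squareSummable A))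

variable {A} in
/-- The sequence of coordinates of an element of `H_A`. -/
def HA.seq (x : HA A) : ℕ → A := x.1

instance : CoeFun (HA A) (fun _ => ℕ → A) := ⟨HA.seq⟩

instance : Inner A (HA A) := ⟨fun x y => ∑' i, star (x i) * y i⟩

instance : Norm (HA A) := ⟨fun x => √‖inner A x x‖⟩

variable {A}

theorem HA.add_apply (x y : HA A) (i : ℕ) : (x + y) i = x i + y i := rfl

theorem HA.zero_apply (i : ℕ) : (0 : HA A) i = 0 := rfl

theorem HA.op_smul_apply (a : A) (x : HA A) (i : ℕ) : (MulOpposite.op a • x) i = x i * a := rfl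

theorem HA.smul_apply (c : ℂ) (x : HA A) (i : ℕ) : (c • x) i = c • x i := rfl

theorem HA.ext {x y : HA A} (h : ∀ i, x i = y i) : x = y := Subtype.ext (funext h)

theorem HA.hasSum_inner (x y : HA A) : HasSum (fun i => star (x i) * y i) (inner A x y) :=
  (summable_inner x.2 y.2).hasSum

theorem HA.inner_add_right (x y z : HA A) : inner A x (y + z) = inner A x y + inner A x z := by
  refine (HA.hasSum_inner x (y + z)).unique ?_
  simpa only [HA.add_apply, mul_add] using (HA.hasSum_inner x y).add (HA.hasSum_inner x z)

theorem HA.inner_op_smul_right (a : A) (x y : HA A) :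
    inner A x (MulOpposite.op a • y) = inner A x y * a := by
  refine (HA.hasSum_inner x (MulOpposite.op a • y)).unique ?_
  simpa only [HA.op_smul_apply, mul_assoc] using (HA.hasSum_inner x y).mul_right a

theorem HA.inner_smul_right (c : ℂ) (x y : HA A) : inner A x (c • y) = c • inner A x y := by
  refine (HA.hasSum_inner x (c • y)).unique ?_
  simpa only [HA.smul_apply, mul_smul_comm] using (HA.hasSum_inner x y).const_smul c

theorem HA.star_inner (x y : HA A) : star (inner A x y) = inner A y x := by
  refine HasSum.unique (HA.hasSum_inner x y).star ?_
  simpa only [star_mul, star_star] using HA.hasSum_inner y x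

theorem HA.inner_add_left (x y z : HA A) : inner A (x + y) z = inner A x z + inner A y z := by
  rw [← HA.star_inner, HA.inner_add_right, star_add, HA.star_inner, HA.star_inner]

theorem HA.inner_smul_left (c : ℂ) (x y : HA A) :
    inner A (c • x) y = star c • inner A x y := by
  rw [← HA.star_inner, HA.inner_smul_right, star_smul, HA.star_inner]

theorem HA.inner_self_eq_zero {x : HA A} : inner A x x = 0 ↔ x = 0 := by
  let _ : PartialOrder A := CStarAlgebra.spectralOrder A
  let _ : StarOrderedRing A := CStarAlgebra.spectralOrderedRing A
  constructor
  · intro h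
    have hs := HA.hasSum_inner x x
    rw [h] at hs
    have h0 := (hasSum_zero_iff_of_nonneg fun i => star_mul_self_nonneg (x i)).1 hs
    exact HA.ext fun i => (CStarRing.star_mul_self_eq_zero_iff _).1 (congrFun h0 i)
  · rintro rfl
    refine (HA.hasSum_inner (0 : HA A) 0).unique ?_
    simpa only [HA.zero_apply, mul_zero] using (hasSum_zero : HasSum (fun _ : ℕ => (0 : A)) 0)

/-- `H_A` is a Hilbert C⋆-module. Mathlib's `CStarModule` is about left modules, and a right
`A`-module is a left module over the opposite algebra. -/
instance [PartialOrder Aᵐᵒᵖ] [StarOrderedRing Aᵐᵒᵖ] : CStarModule Aᵐᵒᵖ (HA A) where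
  inner x y := MulOpposite.op (inner A x y)
  inner_add_right := by simp [HA.inner_add_right]
  inner_self_nonneg {x} := by
    have h := (HA.hasSum_inner x x).op
    rw [← h.tsum_eq]
    refine tsum_nonneg fun i => ?_
    rw [MulOpposite.op_mul, MulOpposite.op_star]
    exact mul_star_self_nonneg _
  inner_self := by simp [HA.inner_self_eq_zero]
  inner_op_smul_right {a x y} := MulOpposite.unop_injective (HA.inner_op_smul_right a.unop x y)
  inner_smul_right_complex := by simp [HA.inner_smul_right]
  star_inner x y := by rw [← MulOpposite.op_star, HA.star_inner]
  norm_eq_sqrt_norm_inner_self x := rfl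

theorem HA.normedSpaceCore : NormedSpace.Core ℂ (HA A) :=
  let _ : PartialOrder Aᵐᵒᵖ := CStarAlgebra.spectralOrder Aᵐᵒᵖ
  let _ : StarOrderedRing Aᵐᵒᵖ := CStarAlgebra.spectralOrderedRing Aᵐᵒᵖ
  CStarModule.normedSpaceCore Aᵐᵒᵖ

instance : NormedAddCommGroup (HA A) := NormedAddCommGroup.ofCore HA.normedSpaceCore

instance : NormedSpace ℂ (HA A) := NormedSpace.ofCore HA.normedSpaceCore

/-! ### Adjointable operators and semi-Fredholm operators -/

variable (A)

/-- `B^a(H_A)`: the algebra of all bounded `A`-linear operators on `H_A` that have an adjoint,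
with the operator norm. -/
def Ba : Subalgebra ℂ (HA A →L[ℂ] HA A) where
  carrier := {F | (∀ (a : A) (x : HA A), F (MulOpposite.op a • x) = MulOpposite.op a • F x) ∧
    ∃ G : HA A →L[ℂ] HA A, ∀ x y : HA A, inner A (F x) y = inner A x (G y)}
  mul_mem' := by
    rintro F₁ F₂ ⟨l₁, G₁, h₁⟩ ⟨l₂, G₂, h₂⟩
    refine ⟨fun a x => ?_, G₂ * G₁, fun x y => ?_⟩
    · simp [l₁, l₂]
    · simp [h₁, h₂]
  add_mem' := by
    rintro F₁ F₂ ⟨l₁, G₁, h₁⟩ ⟨l₂, G₂, h₂⟩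
    refine ⟨fun a x => ?_, G₁ + G₂, fun x y => ?_⟩
    · simp [l₁, l₂]
    · simp [HA.inner_add_left, HA.inner_add_right, h₁, h₂]
  algebraMap_mem' c := by
    refine ⟨fun a x => ?_, algebraMap ℂ _ (star c), fun x y => ?_⟩
    · simp only [Algebra.algebraMap_eq_smul_one, smul_apply,
        one_apply_eq_self]
      exact HA.ext fun i => (smul_mul_assoc c (x i) a).symm
    · simp [Algebra.algebraMap_eq_smul_one, HA.inner_smul_left, HA.inner_smul_right]

variable {A}

/-- The decompositions `H_A = M₁ ∔ N₁` (domain) and `H_A = M₂ ∔ N₂` (range) into closed submodules,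
not necessarily orthogonal, with respect to which `F` has the diagonal matrix `diag (F₁, F₄)` with
`F₁ : M₁ → M₂` an isomorphism. -/
structure IsDecomposition (F : Ba A) (M₁ N₁ M₂ N₂ : Submodule Aᵐᵒᵖ (HA A)) : Prop where
  isClosed_M₁ : IsClosed (M₁ : Set (HA A))
  isClosed_N₁ : IsClosed (N₁ : Set (HA A))
  isClosed_M₂ : IsClosed (M₂ : Set (HA A))
  isClosed_N₂ : IsClosed (N₂ : Set (HA A))
  isCompl₁ : IsCompl M₁ N₁
  isCompl₂ : IsCompl M₂ N₂
  iso : ∃ F₁ : M₁ ≃L[Aᵐᵒᵖ] M₂, ∀ x : M₁, (F₁ x : HA A) = F.1 x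
  mapsTo : ∀ x ∈ N₁, F.1 x ∈ N₂

variable (A)

/-- `MΦ₊(H_A)`: the upper semi-`A`-Fredholm operators. -/
def MPhiPlus : Set (Ba A) :=
  {F | ∃ M₁ N₁ M₂ N₂ : Submodule Aᵐᵒᵖ (HA A), IsDecomposition F M₁ N₁ M₂ N₂ ∧ N₁.FG}

/-- `MΦ₋(H_A)`: the lower semi-`A`-Fredholm operators. -/
def MPhiMinus : Set (Ba A) :=
  {F | ∃ M₁ N₁ M₂ N₂ : Submodule Aᵐᵒᵖ (HA A), IsDecomposition F M₁ N₁ M₂ N₂ ∧ N₂.FG}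

/-- `MΦ(H_A)`: the `A`-Fredholm operators. -/
def MPhi : Set (Ba A) :=
  {F | ∃ M₁ N₁ M₂ N₂ : Submodule Aᵐᵒᵖ (HA A), IsDecomposition F M₁ N₁ M₂ N₂ ∧ N₁.FG ∧ N₂.FG}

end StdHilbert

end

/-! Two facts carry the proof. Stability (`eventually_nhds`): if `D` is close to `F`, its
compression `M₁ → M₂` along `N₂` is close to the isomorphism `F₁`, hence invertible, and `D` then
has a decomposition with the same `M₁` and the same `N₂`. The new `N₁'` is isomorphic to `N₁`, both
being complements of `M₁`, so finite generation of `N₁` or of `N₂` passes between `F` and `D`.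

Rigidity (`fg_codomain`, `fg_domain`): for an operator in `MPhi A`, any decomposition with one of
`N₁`, `N₂` finitely generated has the other finitely generated too. So if `D` were Fredholm, both
complements would be finitely generated for `D`, hence for `F`, making `F` Fredholm. -/

noncomputable section

/-! ### Finite generation of complements: pure module theory. -/

section FinitelyGenerated

open Submodule

variable {R E : Type*} [Ring R] [AddCommGroup E] [Module R E]

/-- The projection onto `N₂` along `M₂` kills `f M₁`, so `N₂` is already the image of `f N₁ + Q`. -/
theorem Submodule.FG.of_isCompl_of_range_sup {f : E →ₗ[R] E} {M₁ N₁ M₂ N₂ Q : Submodule R E}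
    (h₁ : IsCompl M₁ N₁) (h₂ : IsCompl M₂ N₂) (hM : ∀ x ∈ M₁, f x ∈ M₂)
    (hN₁ : N₁.FG) (hQ : Q.FG) (hf : LinearMap.range f ⊔ Q = ⊤) : N₂.FG := by
  have key : N₂ = (N₁.map f ⊔ Q).map (N₂.projection M₂ h₂.symm) := by
    refine le_antisymm (fun y hy => ?_) (map_le_iff_le_comap.2 fun y _ => ?_)
    · obtain ⟨_, ⟨x, rfl⟩, z, hz, rfl⟩ := mem_sup.1 (hf ▸ mem_top : y ∈ LinearMap.range f ⊔ Q)
      obtain ⟨m, hm, n, hn, rfl⟩ := mem_sup.1 (h₁.sup_eq_top ▸ mem_top : x ∈ M₁ ⊔ N₁)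
      refine ⟨f n + z, add_mem_sup (mem_map_of_mem hn) hz, ?_⟩
      rw [map_add f, add_assoc] at hy ⊢
      have h0 : N₂.projection M₂ h₂.symm (f m) = 0 :=
        (projection_apply_eq_zero_iff h₂.symm).2 (hM m hm)
      have h := projection_apply_of_mem_left h₂.symm hy
      rwa [map_add _ (f m), h0, zero_add] at h
    · exact projection_apply_mem h₂.symm y
  rw [key]
  exact ((hN₁.map f).sup hQ).map _

/-- `S` is a left inverse of `f` modulo `K`, so `N₁ ⊆ S N₂ + K`; projecting onto `N₁` along `M₁`
turns the inclusion into an equality. -/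
theorem Submodule.FG.of_isCompl_of_sub_mem {f S : E →ₗ[R] E} {M₁ N₁ N₂ K : Submodule R E}
    (h₁ : IsCompl M₁ N₁) (hN : ∀ x ∈ N₁, f x ∈ N₂) (hN₂ : N₂.FG) (hK : K.FG)
    (hS : ∀ x, x - S (f x) ∈ K) : N₁.FG := by
  have key : N₁ = (N₂.map S ⊔ K).map (N₁.projection M₁ h₁.symm) := by
    refine le_antisymm (fun x hx => ⟨x, ?_, projection_apply_of_mem_left h₁.symm hx⟩)
      (map_le_iff_le_comap.2 fun y _ => projection_apply_mem h₁.symm y)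
    rw [← add_sub_cancel (S (f x)) x]
    exact add_mem_sup (mem_map_of_mem (hN x hx)) (hS x)
  rw [key]
  exact ((hN₂.map S).sup hK).map _

theorem Submodule.FG.of_isCompl_of_isCompl {M N N' : Submodule R E} (h : IsCompl M N)
    (h' : IsCompl M N') (hN : N.FG) : N'.FG := by
  have : Module.Finite R N := Module.Finite.iff_fg.2 hN
  exact Module.Finite.iff_fg.1
    (Module.Finite.equiv ((quotientEquivOfIsCompl M N h).symm ≪≫ₗ quotientEquivOfIsCompl M N' h'))

end FinitelyGenerated

namespace StdHilbert

variable {A : Type*} [CStarAlgebra A]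

/-! ### Completeness of `H_A`. -/

section Complete

theorem HA.norm_sq (x : HA A) : ‖x‖ ^ 2 = ‖inner A x x‖ := Real.sq_sqrt (norm_nonneg _)

theorem HA.norm_sum_le (x : HA A) (s : Finset ℕ) :
    ‖∑ i ∈ s, star (x i) * x i‖ ≤ ‖x‖ ^ 2 := by
  let _ : PartialOrder A := CStarAlgebra.spectralOrder A
  let _ : StarOrderedRing A := CStarAlgebra.spectralOrderedRing A
  rw [HA.norm_sq]
  exact CStarAlgebra.norm_le_norm_of_nonneg_of_le
    (Finset.sum_nonneg fun i _ => star_mul_self_nonneg _)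
    (sum_le_hasSum s (fun i _ => star_mul_self_nonneg _) (HA.hasSum_inner x x))

theorem HA.norm_apply_le (x : HA A) (i : ℕ) : ‖x i‖ ≤ ‖x‖ := by
  have h := HA.norm_sum_le x {i}
  rw [Finset.sum_singleton, CStarRing.norm_star_mul_self, ← sq] at h
  exact le_of_sq_le_sq h (norm_nonneg _)

/-- Parallelogram law for `x - y` and `x`, dropping the positive term from `2x - y`. -/
theorem norm_sum_star_mul_self_le (x y : ℕ → A) (s : Finset ℕ) :
    ‖∑ i ∈ s, star (y i) * y i‖ ≤ 2 * ‖∑ i ∈ s, star (x i - y i) * (x i - y i)‖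
      + 2 * ‖∑ i ∈ s, star (x i) * x i‖ := by
  let _ : PartialOrder A := CStarAlgebra.spectralOrder A
  let _ : StarOrderedRing A := CStarAlgebra.spectralOrderedRing A
  set a := ∑ i ∈ s, star (x i - y i) * (x i - y i) with ha
  set b := ∑ i ∈ s, star (x i) * x i with hb
  have h : ∑ i ∈ s, star (y i) * y i ≤ (a + a) + (b + b) := by
    rw [ha, hb, ← Finset.sum_add_distrib, ← Finset.sum_add_distrib, ← Finset.sum_add_distrib]
    refine Finset.sum_le_sum fun i _ => ?_
    have e : star (x i - y i) * (x i - y i) + star (x i - y i) * (x i - y i)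
        + (star (x i) * x i + star (x i) * x i) = star (y i) * y i
        + star (x i + x i - y i) * (x i + x i - y i) := by
      simp only [star_add, star_sub]
      noncomm_ring
    rw [e]
    exact le_add_of_nonneg_right (star_mul_self_nonneg _)
  calc ‖∑ i ∈ s, star (y i) * y i‖ ≤ ‖(a + a) + (b + b)‖ :=
        CStarAlgebra.norm_le_norm_of_nonneg_of_le
          (Finset.sum_nonneg fun i _ => star_mul_self_nonneg _) h
    _ ≤ (‖a‖ + ‖a‖) + (‖b‖ + ‖b‖) :=
        (norm_add_le _ _).trans (add_le_add (norm_add_le _ _) (norm_add_le _ _))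
    _ = 2 * ‖a‖ + 2 * ‖b‖ := by ring

instance : CompleteSpace (HA A) := by
  refine Metric.complete_of_cauchySeq_tendsto fun u hu => ?_
  have hcoord : ∀ i, CauchySeq fun n => u n i := fun i => by
    rw [Metric.cauchySeq_iff] at hu ⊢
    intro ε hε
    obtain ⟨N, hN⟩ := hu ε hε
    refine ⟨N, fun m hm n hn => lt_of_le_of_lt ?_ (hN m hm n hn)⟩
    rw [dist_eq_norm, dist_eq_norm]
    exact HA.norm_apply_le (u m - u n) i
  choose y hy using fun i => cauchySeq_tendsto_of_complete (hcoord i)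
  -- Let `m → ∞` in the Cauchy estimate on a finite set of coordinates; `N` does not depend on `s`,
  -- so the bound gives both square summability of `y` and norm convergence.
  have hbound : ∀ ε > 0, ∃ N, ∀ n ≥ N, ∀ s : Finset ℕ,
      ‖∑ i ∈ s, star (u n i - y i) * (u n i - y i)‖ ≤ ε ^ 2 := by
    intro ε hε
    obtain ⟨N, hN⟩ := Metric.cauchySeq_iff.1 hu ε hε
    refine ⟨N, fun n hn s => ?_⟩
    have hlim : Filter.Tendsto (fun m => ‖∑ i ∈ s, star (u n i - u m i) * (u n i - u m i)‖)
        Filter.atTop (nhds ‖∑ i ∈ s, star (u n i - y i) * (u n i - y i)‖) :=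
      (tendsto_finsetSum s fun i _ =>
        ((hy i).const_sub (u n i)).star.mul ((hy i).const_sub (u n i))).norm
    refine le_of_tendsto hlim (Filter.eventually_atTop.2 ⟨N, fun m hm => ?_⟩)
    refine (HA.norm_sum_le (u n - u m) s).trans ?_
    have := (hN n hn m hm).le
    rw [dist_eq_norm] at this
    gcongr
  have hsum : Summable fun i => star (y i) * y i := by
    rw [summable_iff_vanishing_norm]
    intro ε hε
    obtain ⟨N, hN⟩ := hbound (√(ε / 8)) (by positivity)
    obtain ⟨s, hs⟩ := summable_iff_vanishing_norm.1 (u N).2 (ε / 8) (by positivity)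
    refine ⟨s, fun t ht => ?_⟩
    have h1 := hN N le_rfl t
    rw [Real.sq_sqrt (by positivity)] at h1
    have h2 : ‖∑ i ∈ t, star (u N i) * u N i‖ < ε / 8 := hs t ht
    linarith [norm_sum_star_mul_self_le (u N) y t]
  let z : HA A := ⟨y, hsum⟩
  refine ⟨z, Metric.tendsto_atTop.2 fun ε hε => ?_⟩
  obtain ⟨N, hN⟩ := hbound (ε / 2) (by positivity)
  refine ⟨N, fun n hn => ?_⟩
  rw [dist_eq_norm]
  have h : ‖inner A (u n - z) (u n - z)‖ ≤ (ε / 2) ^ 2 :=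
    le_of_tendsto (HA.hasSum_inner (u n - z) (u n - z)).norm
      (Filter.Eventually.of_forall fun s => hN n hn s)
  rw [← HA.norm_sq] at h
  exact (le_of_sq_le_sq h (by positivity)).trans_lt (half_lt_self hε)

end Complete

/-! ### Decompositions and their stability. -/

instance : IsScalarTower ℂ Aᵐᵒᵖ (HA A) :=
  ⟨fun c a x => HA.ext fun i => mul_smul_comm c (x i) a.unop⟩

/-- An adjointable operator as an `A`-linear map. -/
def toLin (F : Ba A) : HA A →ₗ[Aᵐᵒᵖ] HA A where
  toFun := F.1
  map_add' := map_add F.1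
  map_smul' a := F.2.1 a.unop

theorem toLin_apply (F : Ba A) (x : HA A) : toLin F x = F.1 x := rfl

/-- Closed complements in a Banach space are topological complements; this is used over `ℂ`, where
the projection is the same map. -/
theorem continuous_projectionOnto {M N : Submodule Aᵐᵒᵖ (HA A)} (h : IsCompl M N)
    (hM : IsClosed (M : Set (HA A))) (hN : IsClosed (N : Set (HA A))) :
    Continuous (M.projectionOnto N h) := by
  have h' : IsCompl (M.restrictScalars ℂ) (N.restrictScalars ℂ) :=
    ⟨Submodule.disjoint_def.2 fun x => Submodule.disjoint_def.1 h.disjoint x,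
      codisjoint_iff.2 (eq_top_iff.2 fun x _ => by
        obtain ⟨m, hm, n, hn, rfl⟩ :=
          Submodule.mem_sup.1 (h.sup_eq_top ▸ Submodule.mem_top : x ∈ M ⊔ N)
        exact Submodule.add_mem_sup (S := M.restrictScalars ℂ) hm hn)⟩
  refine (Submodule.projectionOntoL _ _
    (Submodule.IsCompl.isTopCompl_of_isClosed h' hM hN)).continuous.congr fun x => ?_
  obtain ⟨m, hm, n, hn, rfl⟩ :=
    Submodule.mem_sup.1 (h.sup_eq_top ▸ Submodule.mem_top : x ∈ M ⊔ N)
  have e₁ : M.projectionOnto N h (m + n) = ⟨m, hm⟩ := by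
    rw [map_add, Submodule.projectionOnto_apply_of_mem_left h hm,
      (Submodule.projectionOnto_apply_eq_zero_iff h).2 hn, add_zero]
  have e₂ : (M.restrictScalars ℂ).projectionOnto (N.restrictScalars ℂ) h' (m + n) = ⟨m, hm⟩ := by
    rw [map_add, Submodule.projectionOnto_apply_of_mem_left h' hm,
      (Submodule.projectionOnto_apply_eq_zero_iff h').2 hn, add_zero]
  exact e₂.trans e₁.symm

namespace IsDecomposition

variable {F D : Ba A} {M₁ N₁ M₂ N₂ M₁' N₁' M₂' N₂' : Submodule Aᵐᵒᵖ (HA A)}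

theorem map_mem (h : IsDecomposition F M₁ N₁ M₂ N₂) {x : HA A} (hx : x ∈ M₁) : F.1 x ∈ M₂ := by
  obtain ⟨F₁, hF₁⟩ := h.iso
  exact hF₁ ⟨x, hx⟩ ▸ (F₁ ⟨x, hx⟩).2

theorem range_sup_eq_top (h : IsDecomposition F M₁ N₁ M₂ N₂) :
    LinearMap.range (toLin F) ⊔ N₂ = ⊤ := by
  obtain ⟨F₁, hF₁⟩ := h.iso
  refine eq_top_iff.2 (h.isCompl₂.sup_eq_top.ge.trans (sup_le_sup_right (fun y hy => ?_) _))
  refine ⟨F₁.symm ⟨y, hy⟩, ?_⟩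
  rw [toLin_apply, ← hF₁, F₁.apply_symm_apply]

/-- With `S = F₁⁻¹ P`, `P` the projection onto `M₂` along `N₂`, `x - S (F x)` is the `N₁`-component
of `x`. -/
theorem exists_sub_mem (h : IsDecomposition F M₁ N₁ M₂ N₂) :
    ∃ S : HA A →ₗ[Aᵐᵒᵖ] HA A, ∀ x, x - S (toLin F x) ∈ N₁ := by
  obtain ⟨F₁, hF₁⟩ := h.iso
  refine ⟨M₁.subtype ∘ₗ F₁.symm.toLinearMap ∘ₗ M₂.projectionOnto N₂ h.isCompl₂, fun x => ?_⟩
  obtain ⟨m, hm, n, hn, rfl⟩ :=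
    Submodule.mem_sup.1 (h.isCompl₁.sup_eq_top ▸ Submodule.mem_top : x ∈ M₁ ⊔ N₁)
  have h1 : M₂.projectionOnto N₂ h.isCompl₂ (F.1 m) = F₁ ⟨m, hm⟩ := by
    rw [← hF₁ ⟨m, hm⟩, Submodule.projectionOnto_apply_left]
  have h2 : M₂.projectionOnto N₂ h.isCompl₂ (F.1 n) = 0 :=
    (Submodule.projectionOnto_apply_eq_zero_iff _).2 (h.mapsTo n hn)
  simpa [toLin_apply, h1, h2] using hn

theorem fg_codomain (h : IsDecomposition F M₁ N₁ M₂ N₂) (hN₁ : N₁.FG) (hF : F ∈ MPhi A) :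
    N₂.FG := by
  obtain ⟨_, _, _, Q, h', -, hQ⟩ := hF
  exact .of_isCompl_of_range_sup h.isCompl₁ h.isCompl₂ (fun x => h.map_mem) hN₁ hQ
    h'.range_sup_eq_top

theorem fg_domain (h : IsDecomposition F M₁ N₁ M₂ N₂) (hN₂ : N₂.FG) (hF : F ∈ MPhi A) :
    N₁.FG := by
  obtain ⟨_, K, _, _, h', hK, -⟩ := hF
  obtain ⟨S, hS⟩ := h'.exists_sub_mem
  exact .of_isCompl_of_sub_mem h.isCompl₁ h.mapsTo hN₂ hK hS

/-- A decomposition of `F` is inherited by `D` if the compression of `D` to `M₁ → M₂` is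
invertible; the summands `M₁` and `N₂` are kept. -/
theorem of_compression (h : IsDecomposition F M₁ N₁ M₂ N₂) (T : M₁ ≃L[ℂ] M₂)
    (hT : ∀ x : M₁, T x = M₂.projectionOnto N₂ h.isCompl₂ (D.1 x)) :
    ∃ N₁' M₂', IsDecomposition D M₁ N₁' M₂' N₂ := by
  set P := M₂.projectionOnto N₂ h.isCompl₂
  have hPc : Continuous P := continuous_projectionOnto h.isCompl₂ h.isClosed_M₂ h.isClosed_N₂
  have hP0 : ∀ y, P y = 0 ↔ y ∈ N₂ := fun y => Submodule.projectionOnto_apply_eq_zero_iff _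
  have hTD : ∀ x : M₁, T.symm (P (D.1 x)) = x := fun x => by rw [← hT, T.symm_apply_apply]
  have hDT : ∀ y, P (D.1 (T.symm (P y))) = P y := fun y => by rw [← hT, T.apply_symm_apply]
  have hmem : ∀ y, y ∈ M₁.map (toLin D) ↔ D.1 (T.symm (P y)) = y := by
    refine fun y => ⟨?_, fun hy => ⟨T.symm (P y), (T.symm (P y)).2, hy⟩⟩
    rintro ⟨x, hx, rfl⟩
    exact congrArg (fun z : M₁ => D.1 z) (hTD ⟨x, hx⟩)
  -- `T⁻¹ P D` is idempotent with range `M₁` and kernel `D⁻¹ N₂`; `D T⁻¹ P` is idempotent with range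
  -- `D M₁` and kernel `N₂`. Continuity of the latter makes `D M₁` closed, as its fixed-point set.
  refine ⟨N₂.comap (toLin D), M₁.map (toLin D), h.isClosed_M₁,
    h.isClosed_N₂.preimage D.1.continuous, ?_, h.isClosed_N₂, ?_, ?_, ?_, fun x hx => hx⟩
  · have : (M₁.map (toLin D) : Set (HA A)) = {y | D.1 (T.symm (P y)) = y} :=
      Set.ext hmem
    rw [this]
    exact isClosed_eq (D.1.continuous.comp
      (continuous_subtype_val.comp (T.symm.continuous.comp hPc))) continuous_id
  · refine ⟨Submodule.disjoint_def.2 fun x hx hx' => ?_,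
      codisjoint_iff.2 (eq_top_iff.2 fun x _ => ?_)⟩
    · have h0 : P (D.1 x) = 0 := (hP0 _).2 hx'
      have := hTD ⟨x, hx⟩
      rw [h0, map_zero] at this
      exact congrArg Subtype.val this.symm
    · rw [← add_sub_cancel (T.symm (P (D.1 x)) : HA A) x]
      refine Submodule.add_mem_sup (T.symm _).2 ?_
      rw [Submodule.mem_comap, toLin_apply, ← hP0, map_sub, map_sub, hDT, sub_self]
  · refine ⟨Submodule.disjoint_def.2 fun y hy hy' => ?_,
      codisjoint_iff.2 (eq_top_iff.2 fun y _ => ?_)⟩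
    · rw [← (hmem y).1 hy, (hP0 y).2 hy', map_zero, Submodule.coe_zero, map_zero]
    · rw [← add_sub_cancel (D.1 (T.symm (P y))) y]
      refine Submodule.add_mem_sup (Submodule.mem_map_of_mem (T.symm _).2) ?_
      rw [← hP0, map_sub, hDT, sub_self]
  -- `T` is only `ℂ`-linear, but it merely supplies the continuous inverse `T⁻¹ P` of the `A`-linear
  -- map `D₁`.
  · let D₁ : M₁ →ₗ[Aᵐᵒᵖ] M₁.map (toLin D) :=
      (toLin D).restrict fun _ hx => Submodule.mem_map_of_mem hx
    have hleft : Function.LeftInverse (fun y : M₁.map (toLin D) => T.symm (P y)) D₁ := hTD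
    have hright : Function.RightInverse (fun y : M₁.map (toLin D) => T.symm (P y)) D₁ :=
      fun y => Subtype.ext ((hmem y).1 y.2)
    exact ⟨{ D₁ with
      invFun := fun y => T.symm (P y)
      left_inv := hleft
      right_inv := hright
      continuous_toFun := (D.1.continuous.comp continuous_subtype_val).subtype_mk _
      continuous_invFun := T.symm.continuous.comp (hPc.comp continuous_subtype_val) },
      fun x => rfl⟩

theorem eventually_nhds (h : IsDecomposition F M₁ N₁ M₂ N₂) :
    ∀ᶠ D in nhds F, ∃ N₁' M₂', IsDecomposition D M₁ N₁' M₂' N₂ := by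
  let P : HA A →L[ℂ] M₂ := ⟨(M₂.projectionOnto N₂ h.isCompl₂).restrictScalars ℂ,
    continuous_projectionOnto h.isCompl₂ h.isClosed_M₂ h.isClosed_N₂⟩
  let i : M₁ →L[ℂ] HA A := ⟨M₁.subtype.restrictScalars ℂ, continuous_subtype_val⟩
  have : CompleteSpace M₁ := h.isClosed_M₁.completeSpace_coe
  obtain ⟨F₁, hF₁⟩ := h.iso
  let T : M₁ ≃L[ℂ] M₂ := { F₁.toLinearEquiv.restrictScalars ℂ with
    continuous_toFun := F₁.continuous
    continuous_invFun := F₁.symm.continuous }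
  have hc : Continuous fun D : Ba A => P ∘L D.1 ∘L i :=
    continuous_const.clm_comp (continuous_subtype_val.clm_comp continuous_const)
  have hT : P ∘L F.1 ∘L i = T := by
    ext1 x
    change M₂.projectionOnto N₂ h.isCompl₂ (F.1 x) = F₁ x
    rw [← hF₁, Submodule.projectionOnto_apply_left]
  -- Invertible operators form an open set, `M₁` being complete.
  have hn := T.nhds
  rw [← hT] at hn
  filter_upwards [hc.continuousAt hn] with D ⟨e, he⟩
  exact h.of_compression e fun x => DFunLike.congr_fun he x

end IsDecomposition

end StdHilbert

end

theorem theorem4p1 (A : Type*) [CStarAlgebra A] :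
    IsOpen (StdHilbert.MPhiPlus A \ StdHilbert.MPhi A) ∧
      IsOpen (StdHilbert.MPhiMinus A \ StdHilbert.MPhi A) := by
  refine ⟨isOpen_iff_mem_nhds.2 ?_, isOpen_iff_mem_nhds.2 ?_⟩
  · rintro F ⟨⟨M₁, N₁, M₂, N₂, h, hN₁⟩, hF⟩
    filter_upwards [h.eventually_nhds] with D ⟨N₁', M₂', hD⟩
    have hN₁' := hN₁.of_isCompl_of_isCompl h.isCompl₁ hD.isCompl₁
    exact ⟨⟨_, _, _, _, hD, hN₁'⟩,
      fun hDΦ => hF ⟨_, _, _, _, h, hN₁, hD.fg_codomain hN₁' hDΦ⟩⟩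
  · rintro F ⟨⟨M₁, N₁, M₂, N₂, h, hN₂⟩, hF⟩
    filter_upwards [h.eventually_nhds] with D ⟨N₁', M₂', hD⟩
    exact ⟨⟨_, _, _, _, hD, hN₂⟩, fun hDΦ => hF ⟨_, _, _, _, h,
      (hD.fg_domain hN₂ hDΦ).of_isCompl_of_isCompl hD.isCompl₁ h.isCompl₁, hN₂⟩⟩
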